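/- Let $n\ge 0$ be an integer. Let $V_n=\{(i,j)\in\mathbb Z^2 : |i|+|j|\le n,\ j\le 0,\ i+j\equiv n \pmod 2\}$, and call two points of $V_n$ neighbours if they differ by one of $\pm(2,0),\pm(1,1),\pm(1,-1)$. Consider the following sets of boundary points of $V_n$: - the corners $\{(-n,0)\}$, $\{(n,0)\}$, $\{(0,-n)\}$; - the west pairs $\{(-i,0),(\frac{-n-i}{2},\frac{-n+i}{2})\}$ and the east pairs $\{(i,0),(\frac{n+i}{2},\frac{-n+i}{2})\}$ for $0<i<n$, $i\equiv n\pmod 2$; - the south pairs $\{(-n+i,-i),(n-i,-i)\}$ for integers $i$ with $\frac n2<i<n$; - if $n$ is even, the middle triplet $\{(0,0),(-\frac n2,-\frac n2),(\frac n2,-\frac n2)\}$. A simplified grove of size $n$ is an acyclic graph with vertex set $V_n$, all of whose edges join neighbours, such that every connected component contains exactly one of these sets and each of these sets is contained in some component. The target grove of size $n$ is the graph on $V_n$ that consists, for every integer $0<k<n$ and with $m=\min(k,n-k)$, of the $m$ edges between neighbours on the straight path from $(-n+2k,0)$ to $(-n+2k+m,-m)$ and of the $m$ edges between neighbours on the straight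 path from $(-n+k,-k)$ to $(-n+k+2m,-k)$. A spin is a change from one simplified grove of size $n$ to another that replaces one edge $pq$ by an edge $pq'$ that was not present, where $p,q,q'$ are pairwise neighbours (the edge is rotated by $60^\circ$, in either direction, about the pivot $p$). **Theorem.** Every simplified grove $G$ of size $n$ can be turned into the target grove of size $n$ by a finite sequence of spins. -/

import Mathlib

namespace Grove

/-- Membership in the triangular array of size `n`: the points `(i, j)` of `ℤ × ℤ` with
`|i| + |j| ≤ n`, `j ≤ 0` and `i + j ≡ n (mod 2)`. Its corners are `(-n, 0)`, `(n, 0)`, `(0, -n)`. -/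
def InTriangle (n : ℕ) (v : ℤ × ℤ) : Prop :=
  |v.1| + |v.2| ≤ (n : ℤ) ∧ v.2 ≤ 0 ∧ v.1 + v.2 ≡ (n : ℤ) [ZMOD 2]

/-- The vertices of the groves of size `n`. -/
abbrev Vertex (n : ℕ) : Type := {v : ℤ × ℤ // InTriangle n v}

/-- The triangular lattice graph on the vertices: each point has the (at most six) neighbours
`(i ± 2, j)`, `(i ± 1, j + 1)`, `(i ± 1, j - 1)`. -/
def lattice (n : ℕ) : SimpleGraph (Vertex n) where
  Adj u v :=
    (v.1.2 = u.1.2 ∧ (v.1.1 = u.1.1 + 2 ∨ v.1.1 = u.1.1 - 2)) ∨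
    ((v.1.2 = u.1.2 + 1 ∨ v.1.2 = u.1.2 - 1) ∧ (v.1.1 = u.1.1 + 1 ∨ v.1.1 = u.1.1 - 1))
  symm := ⟨fun u v h => by omega⟩
  loopless := ⟨fun u h => by omega⟩

/-- The prescribed sets of boundary vertices: the three corners, the west pairs, the east pairs,
the south pairs and, when `n` is even, the middle triplet. (All the halves that occur are halves
of even integers.) -/
inductive IsBoundaryBlock (n : ℕ) : Set (ℤ × ℤ) → Prop
  | cornerWest : IsBoundaryBlock n {(-(n : ℤ), 0)}
  | cornerEast : IsBoundaryBlock n {((n : ℤ), 0)}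
  | cornerSouth : IsBoundaryBlock n {(0, -(n : ℤ))}
  | west (i : ℤ) (h0 : 0 < i) (hn : i < n) (hi : i ≡ (n : ℤ) [ZMOD 2]) :
      IsBoundaryBlock n {(-i, 0), ((-n - i) / 2, (-n + i) / 2)}
  | east (i : ℤ) (h0 : 0 < i) (hn : i < n) (hi : i ≡ (n : ℤ) [ZMOD 2]) :
      IsBoundaryBlock n {(i, 0), ((n + i) / 2, (-n + i) / 2)}
  | south (i : ℤ) (h0 : (n : ℤ) < 2 * i) (hn : i < n) :
      IsBoundaryBlock n {(-n + i, -i), (n - i, -i)}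
  | middle (hn : Even n) :
      IsBoundaryBlock n {(0, 0), (-((n : ℤ) / 2), -((n : ℤ) / 2)), ((n : ℤ) / 2, -((n : ℤ) / 2))}

/-- The set of points of the plane that a connected component occupies. -/
def componentPoints {n : ℕ} {G : SimpleGraph (Vertex n)} (C : G.ConnectedComponent) :
    Set (ℤ × ℤ) :=
  Subtype.val '' C.supp

/-- `G` is a simplified grove of size `n`: an acyclic graph on the triangular array, with edges
joining neighbouring points, each of whose components contains exactly one of the prescribed sets
of boundary vertices, and such that each prescribed set is contained in some component. -/
structure IsSimplifiedGrove (n : ℕ) (G : SimpleGraph (Vertex n)) : Prop where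
  le_lattice : G ≤ lattice n
  acyclic : G.IsAcyclic
  component_contains : ∀ C : G.ConnectedComponent,
    ∃! S : Set (ℤ × ℤ), IsBoundaryBlock n S ∧ S ⊆ componentPoints C
  contained : ∀ S : Set (ℤ × ℤ), IsBoundaryBlock n S →
    ∃ C : G.ConnectedComponent, S ⊆ componentPoints C

/-- The target grove of size `n`. For each `0 < k < n`, with `m = min k (n - k)`, it has
* the `m` edges of the straight path going down to the right from `(-n + 2k, 0)` to
  `(-n + 2k + m, -m)`, and
* the `m` edges of the horizontal path going right from `(-n + k, -k)` to `(-n + k + 2m, -k)`.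

The condition `t < min k (n - k)` is written as `t < k ∧ t + k < n`. -/
def targetGrove (n : ℕ) : SimpleGraph (Vertex n) :=
  SimpleGraph.fromRel fun u v =>
    ∃ k t : ℕ, t < k ∧ t + k < n ∧
      ((u.1 = (-(n : ℤ) + 2 * k + t, -(t : ℤ)) ∧
          v.1 = (-(n : ℤ) + 2 * k + t + 1, -(t : ℤ) - 1)) ∨
        (u.1 = (-(n : ℤ) + k + 2 * t, -(k : ℤ)) ∧
          v.1 = (-(n : ℤ) + k + 2 * t + 2, -(k : ℤ))))

/-- `G'` arises from `G` by rotating one edge by 60 degrees, in either direction, about one of its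
endpoints `p`, the pivot: the edge `pq` of `G` is replaced by `pq'`, which is not an edge of `G`,
where `p`, `q`, `q'` are the vertices of a unit triangle of the lattice. -/
def IsSpin {n : ℕ} (G G' : SimpleGraph (Vertex n)) : Prop :=
  ∃ p q q' : Vertex n,
    (lattice n).Adj p q ∧ (lattice n).Adj p q' ∧ (lattice n).Adj q q' ∧
    G.Adj p q ∧ ¬ G.Adj p q' ∧ G'.edgeSet = (G.edgeSet \ {s(p, q)}) ∪ {s(p, q')}

/-- A spin that turns a simplified grove into a simplified grove. -/
def GroveSpin (n : ℕ) (G G' : SimpleGraph (Vertex n)) : Prop :=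
  IsSimplifiedGrove n G ∧ IsSimplifiedGrove n G' ∧ IsSpin G G'

end Grove

namespace Grove

section Reaches

variable {α : Type*}

/-- `v` lies on the forward orbit of `u` under `π`. -/
def Reaches (π : α → α) (u v : α) : Prop := ∃ m : ℕ, π^[m] u = v

namespace Reaches

variable {π : α → α} {u v w : α}

theorem refl (u : α) : Reaches π u u := ⟨0, rfl⟩

theorem trans (h : Reaches π u v) (h' : Reaches π v w) : Reaches π u w := by
  obtain ⟨a, rfl⟩ := h
  obtain ⟨b, rfl⟩ := h'
  exact ⟨b + a, Function.iterate_add_apply π b a u⟩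

theorem step (u : α) : Reaches π u (π u) := ⟨1, rfl⟩

theorem of_eq (h : π u = v) : Reaches π u v := ⟨1, h⟩

/-- Induction along the orbit that leads from a point to a fixed goal. -/
theorem head_induction {P : α → Prop} (h : Reaches π u v) (base : P v)
    (ih : ∀ x, Reaches π (π x) v → P (π x) → P x) : P u := by
  obtain ⟨m, hm⟩ := h
  induction m generalizing u with
  | zero => exact (show u = v from hm) ▸ base
  | succ m IH => exact ih u ⟨m, hm⟩ (IH hm)

theorem total (h : Reaches π u v) (h' : Reaches π u w) : Reaches π v w ∨ Reaches π w v := by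
  obtain ⟨a, rfl⟩ := h
  obtain ⟨b, rfl⟩ := h'
  rcases le_total a b with hab | hab
  · obtain ⟨c, rfl⟩ := Nat.exists_eq_add_of_le' hab
    exact .inl ⟨c, (Function.iterate_add_apply π c a u).symm⟩
  · obtain ⟨c, rfl⟩ := Nat.exists_eq_add_of_le' hab
    exact .inr ⟨c, (Function.iterate_add_apply π c b u).symm⟩

theorem eq_of_fixed (hu : π u = u) (h : Reaches π u v) : v = u := by
  obtain ⟨a, rfl⟩ := h
  exact Function.iterate_fixed hu a

theorem of_fixed (h : Reaches π u v) (h' : Reaches π u w) (hw : π w = w) : Reaches π v w := by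
  rcases total h h' with h1 | h1
  · exact h1
  · rw [eq_of_fixed hw h1]; exact refl _

theorem fixed_unique (h : Reaches π u v) (h' : Reaches π u w) (hv : π v = v) (hw : π w = w) :
    v = w :=
  (eq_of_fixed hv (of_fixed h h' hw)).symm

theorem antisymm {ρ : α} (hρ : π ρ = ρ) (hu : Reaches π u ρ) (h : Reaches π u v)
    (h' : Reaches π v u) : u = v := by
  obtain ⟨a, ha⟩ := h
  obtain ⟨b, hb⟩ := h'
  obtain ⟨m, hm⟩ := hu
  rcases Nat.eq_zero_or_pos (b + a) with h0 | h0
  · obtain rfl : a = 0 := by omega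
    exact ha
  · have hp : π^[b + a] u = u := by rw [Function.iterate_add_apply, ha, hb]
    have h1 : π^[(b + a) * m] u = u := by
      rw [Function.iterate_mul]; exact Function.iterate_fixed hp m
    have h2 : π^[(b + a) * m] u = ρ := by
      obtain ⟨c, hc⟩ := Nat.exists_eq_add_of_le' (Nat.le_mul_of_pos_left m h0)
      rw [hc, Function.iterate_add_apply, hm]; exact Function.iterate_fixed hρ c
    have h3 : u = ρ := h1.symm.trans h2
    subst h3
    rw [← ha]; exact (Function.iterate_fixed hρ a).symm

variable [DecidableEq α] {p y : α}

theorem update_or (h : Reaches π u v) :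
    Reaches (Function.update π p y) u v ∨ Reaches (Function.update π p y) u p := by
  refine head_induction (P := fun x => Reaches (Function.update π p y) x v ∨
    Reaches (Function.update π p y) x p) h (.inl (refl _)) fun x _ ih => ?_
  by_cases hx : x = p
  · exact .inr (hx ▸ refl _)
  · have hs : Reaches (Function.update π p y) x (π x) :=
      of_eq (Function.update_of_ne hx _ _)
    exact ih.imp hs.trans hs.trans

theorem of_update (h : Reaches (Function.update π p y) u p) : Reaches π u p := by
  refine head_induction (P := fun x => Reaches π x p) h (refl _) fun x _ ih => ?_
  by_cases hx : x = p
  · exact hx ▸ refl _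
  · rw [Function.update_of_ne hx] at ih
    exact (step x).trans ih

theorem update_of_not (h : Reaches π u v) (hu : ¬ Reaches π u p) :
    Reaches (Function.update π p y) u v :=
  (update_or h).resolve_right fun h' => hu (of_update h')

end Reaches

end Reaches

section Coordinates

variable {n : ℕ}

/-- The first lattice coordinate of a vertex: the index of the diagonal that carries it. -/
def col (v : Vertex n) : ℤ := (v.1.1 + v.1.2 + n) / 2

/-- The second lattice coordinate of a vertex: its depth below the top side. -/
def row (v : Vertex n) : ℤ := -v.1.2

theorem coords (v : Vertex n) :
    0 ≤ col v ∧ 0 ≤ row v ∧ col v + row v ≤ n ∧ v.1.1 = -n + 2 * col v + row v ∧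
      v.1.2 = -row v := by
  obtain ⟨⟨i, j⟩, h1, h2, h3⟩ := v
  change |i| + |j| ≤ (n : ℤ) at h1
  change j ≤ 0 at h2
  change i + j ≡ n [ZMOD 2] at h3
  simp only [col, row]
  unfold Int.ModEq at h3
  rw [abs_of_nonpos h2] at h1
  have h5 := le_abs_self i
  have h6 := neg_abs_le i
  omega

theorem vertex_ext {u v : Vertex n} (hc : col u = col v) (hr : row u = row v) : u = v := by
  have hu := coords u
  have hv := coords v
  apply Subtype.ext
  apply Prod.ext <;> omega

/-- The vertex with given coordinates, or the corner `(-n, 0)` if there is none. -/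
def pt (n : ℕ) (c r : ℤ) : Vertex n :=
  if h : 0 ≤ c ∧ 0 ≤ r ∧ c + r ≤ n then
    ⟨(-n + 2 * c + r, -r), by
      refine ⟨?_, by simp only; omega, by simp only [Int.ModEq]; omega⟩
      simp only
      rw [abs_of_nonpos (a := -r) (by omega)]
      have : |-(n : ℤ) + 2 * c + r| ≤ n - r := abs_le.2 ⟨by omega, by omega⟩
      omega⟩
  else ⟨(-n, 0), by
    refine ⟨?_, le_refl _, by simp only [Int.ModEq]; omega⟩
    simp⟩

theorem pt_coords {c r : ℤ} (h : 0 ≤ c ∧ 0 ≤ r ∧ c + r ≤ n) :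
    col (pt n c r) = c ∧ row (pt n c r) = r := by
  unfold pt
  rw [dif_pos h]
  simp only [col, row]
  omega

theorem lattice_adj_iff {u v : Vertex n} : (lattice n).Adj u v ↔
    (row v = row u ∧ (col v = col u + 1 ∨ col v = col u - 1)) ∨
    (row v = row u + 1 ∧ (col v = col u ∨ col v = col u - 1)) ∨
    (row v = row u - 1 ∧ (col v = col u ∨ col v = col u + 1)) := by
  have hu := coords u
  have hv := coords v
  simp only [lattice]
  omega

/-- The vertex lies on a side of the triangle. -/
def OnBoundary (v : Vertex n) : Prop := col v = 0 ∨ row v = 0 ∨ col v + row v = n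

/-- The parent map of the target grove. The points with `col ≤ row` are joined to the left in their
row, the other ones downwards in their diagonal. -/
def next (v : Vertex n) : Vertex n :=
  if col v ≤ row v then (if col v = 0 then v else pt n (col v - 1) (row v))
  else (if col v + row v = n then v else pt n (col v) (row v + 1))

/-- The boundary point to which `next` leads. -/
def lineRoot (v : Vertex n) : Vertex n :=
  if col v ≤ row v ∨ 2 * col v ≤ n then pt n 0 (max (col v) (row v)) else pt n (col v) (n - col v)

/-- The roots, one in each of the prescribed boundary sets. -/
def IsRoot (v : Vertex n) : Prop := col v = 0 ∨ (row v < col v ∧ col v + row v = n)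

theorem next_coords (v : Vertex n) :
    (IsRoot v ∧ next v = v) ∨
    (¬ IsRoot v ∧ col v ≤ row v ∧ 0 < col v ∧ col (next v) = col v - 1 ∧ row (next v) = row v) ∨
    (¬ IsRoot v ∧ row v < col v ∧ col v + row v < n ∧ col (next v) = col v ∧
      row (next v) = row v + 1) := by
  have hv := coords v
  unfold next IsRoot
  split_ifs with h1 h2 h2
  · exact .inl ⟨.inl h2, rfl⟩
  · have := @pt_coords n (col v - 1) (row v) (by omega)
    omega
  · exact .inl ⟨.inr ⟨by omega, h2⟩, rfl⟩
  · have := @pt_coords n (col v) (row v + 1) (by omega)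
    omega

theorem lineRoot_coords (v : Vertex n) :
    ((col v ≤ row v ∨ 2 * col v ≤ n) ∧ col (lineRoot v) = 0 ∧
      row (lineRoot v) = max (col v) (row v)) ∨
    (row v < col v ∧ (n : ℤ) < 2 * col v ∧ col (lineRoot v) = col v ∧
      row (lineRoot v) = n - col v) := by
  have hv := coords v
  unfold lineRoot
  split_ifs with h1
  · have := @pt_coords n 0 (max (col v) (row v)) (by omega)
    omega
  · have := @pt_coords n (col v) (n - col v) (by omega)
    omega

theorem isRoot_lineRoot (v : Vertex n) : IsRoot (lineRoot v) := by
  have h := lineRoot_coords v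
  have h' := coords (lineRoot v)
  unfold IsRoot
  omega

theorem IsRoot.onBoundary {v : Vertex n} (h : IsRoot v) : OnBoundary v := by
  unfold IsRoot at h
  unfold OnBoundary
  omega

theorem IsRoot.lineRoot_eq {v : Vertex n} (h : IsRoot v) : lineRoot v = v := by
  have h1 := lineRoot_coords v
  have h2 := coords v
  unfold IsRoot at h
  apply vertex_ext <;> omega

theorem lineRoot_next (v : Vertex n) : lineRoot (next v) = lineRoot v := by
  have h1 := lineRoot_coords v
  have h2 := coords v
  have h3 := lineRoot_coords (next v)
  rcases next_coords v with ⟨-, h⟩ | h | h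
  · rw [h]
  all_goals apply vertex_ext <;> omega

end Coordinates

section Blocks

variable {n : ℕ}

/-- The vertices of the prescribed boundary set that contains the root `ρ`. -/
def block (ρ : Vertex n) : Set (ℤ × ℤ) :=
  Subtype.val '' {b : Vertex n | OnBoundary b ∧ lineRoot b = ρ}

theorem mem_block {b ρ : Vertex n} : b.1 ∈ block ρ ↔ OnBoundary b ∧ lineRoot b = ρ :=
  Function.Injective.mem_set_image Subtype.val_injective

theorem IsRoot.mem_block {ρ : Vertex n} (h : IsRoot ρ) : ρ.1 ∈ block ρ :=
  Grove.mem_block.2 ⟨h.onBoundary, h.lineRoot_eq⟩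

theorem pt_val {c r : ℤ} (h : 0 ≤ c ∧ 0 ≤ r ∧ c + r ≤ n) :
    (pt n c r).1 = (-(n : ℤ) + 2 * c + r, -r) := by
  unfold pt
  rw [dif_pos h]

theorem val_eq_iff {v : Vertex n} {i j : ℤ} :
    v.1 = (i, j) ↔ i = -n + 2 * col v + row v ∧ j = -row v := by
  have := coords v
  rw [Prod.ext_iff]
  simp only
  omega

theorem eq_block {ρ : Vertex n} {S : Set (ℤ × ℤ)}
    (h1 : ∀ x ∈ S, 0 ≤ -x.2 ∧ |x.1| ≤ n + x.2 ∧ (n + x.1 + x.2) % 2 = 0)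
    (h2 : ∀ b : Vertex n, b.1 ∈ S ↔ OnBoundary b ∧ lineRoot b = ρ) : S = block ρ := by
  ext ⟨i, j⟩
  constructor
  · intro h
    obtain ⟨h3, h4, h5⟩ := h1 _ h
    simp only at h3 h4 h5
    rw [abs_le] at h4
    have h6 := @pt_val n ((n + i + j) / 2) (-j) (by omega)
    have h7 : (i, j) = (pt n ((n + i + j) / 2) (-j)).1 := by
      rw [h6]; apply Prod.ext <;> simp only <;> omega
    rw [h7] at h ⊢
    exact mem_block.2 ((h2 _).1 h)
  · rintro ⟨b, hb, hb'⟩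
    rw [← hb']
    exact (h2 b).2 hb

theorem IsBoundaryBlock.exists_eq_block {S : Set (ℤ × ℤ)} (hS : IsBoundaryBlock n S) :
    ∃ ρ : Vertex n, IsRoot ρ ∧ S = block ρ := by
  have key : ∀ ρ b : Vertex n, lineRoot b = ρ ↔ col (lineRoot b) = col ρ ∧
      row (lineRoot b) = row ρ := fun ρ b =>
    ⟨fun h => by rw [h]; exact ⟨rfl, rfl⟩, fun h => vertex_ext h.1 h.2⟩
  obtain (_ | _ | _ | ⟨i, h0, hn, hi⟩ | ⟨i, h0, hn, hi⟩ | ⟨i, h0, hn⟩ | hn) := hS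
  · obtain ⟨hc, hr⟩ := @pt_coords n 0 0 (by omega)
    refine ⟨pt n 0 0, .inl hc, eq_block ?_ fun b => ?_⟩
    · simp
    · have hb := coords b
      have hl := lineRoot_coords b
      simp only [Set.mem_singleton_iff, val_eq_iff, key, OnBoundary]
      omega
  · obtain ⟨hc, hr⟩ := @pt_coords n n 0 (by omega)
    refine ⟨pt n n 0, by unfold IsRoot; omega, eq_block ?_ fun b => ?_⟩
    · simp; omega
    · have hb := coords b
      have hl := lineRoot_coords b
      simp only [Set.mem_singleton_iff, val_eq_iff, key, OnBoundary]
      omega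
  · obtain ⟨hc, hr⟩ := @pt_coords n 0 n (by omega)
    refine ⟨pt n 0 n, .inl hc, eq_block ?_ fun b => ?_⟩
    · simp
    · have hb := coords b
      have hl := lineRoot_coords b
      simp only [Set.mem_singleton_iff, val_eq_iff, key, OnBoundary]
      omega
  · unfold Int.ModEq at hi
    obtain ⟨hc, hr⟩ := @pt_coords n 0 ((n - i) / 2) (by omega)
    refine ⟨pt n 0 ((n - i) / 2), .inl hc, eq_block ?_ fun b => ?_⟩
    · simp only [Set.mem_insert_iff, Set.mem_singleton_iff, forall_eq_or_imp, forall_eq, abs_le]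
      omega
    · have hb := coords b
      have hl := lineRoot_coords b
      simp only [Set.mem_insert_iff, Set.mem_singleton_iff, val_eq_iff, key, OnBoundary]
      omega
  · unfold Int.ModEq at hi
    obtain ⟨hc, hr⟩ := @pt_coords n ((n + i) / 2) ((n - i) / 2) (by omega)
    refine ⟨pt n ((n + i) / 2) ((n - i) / 2), by unfold IsRoot; omega, eq_block ?_ fun b => ?_⟩
    · simp only [Set.mem_insert_iff, Set.mem_singleton_iff, forall_eq_or_imp, forall_eq, abs_le]
      omega
    · have hb := coords b
      have hl := lineRoot_coords b
      simp only [Set.mem_insert_iff, Set.mem_singleton_iff, val_eq_iff, key, OnBoundary]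
      omega
  · obtain ⟨hc, hr⟩ := @pt_coords n 0 i (by omega)
    refine ⟨pt n 0 i, .inl hc, eq_block ?_ fun b => ?_⟩
    · simp only [Set.mem_insert_iff, Set.mem_singleton_iff, forall_eq_or_imp, forall_eq, abs_le]
      omega
    · have hb := coords b
      have hl := lineRoot_coords b
      simp only [Set.mem_insert_iff, Set.mem_singleton_iff, val_eq_iff, key, OnBoundary]
      omega
  · obtain ⟨m, rfl⟩ := hn
    obtain ⟨hc, hr⟩ := @pt_coords (m + m) 0 m (by omega)
    refine ⟨pt (m + m) 0 m, .inl hc, eq_block ?_ fun b => ?_⟩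
    · simp only [Set.mem_insert_iff, Set.mem_singleton_iff, forall_eq_or_imp, forall_eq, abs_le]
      omega
    · have hb := coords b
      have hl := lineRoot_coords b
      simp only [Set.mem_insert_iff, Set.mem_singleton_iff, val_eq_iff, key, OnBoundary]
      omega

theorem IsRoot.exists_isBoundaryBlock {ρ : Vertex n} (hρ : IsRoot ρ) :
    ∃ S, IsBoundaryBlock n S ∧ ρ.1 ∈ S := by
  have hcρ := coords ρ
  by_cases h0 : col ρ = 0
  · rcases lt_trichotomy (2 * row ρ) n with h | h | h
    · by_cases h1 : row ρ = 0
      · exact ⟨_, .cornerWest, by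
          simp only [Set.mem_singleton_iff, val_eq_iff]; omega⟩
      · exact ⟨_, .west (n - 2 * row ρ) (by omega) (by omega) (by unfold Int.ModEq; omega), by
          simp only [Set.mem_insert_iff, Set.mem_singleton_iff, val_eq_iff]; omega⟩
    · exact ⟨_, .middle (by rw [Nat.even_iff]; omega), by
        simp only [Set.mem_insert_iff, Set.mem_singleton_iff, val_eq_iff]; omega⟩
    · by_cases h1 : row ρ = n
      · exact ⟨_, .cornerSouth, by
          simp only [Set.mem_singleton_iff, val_eq_iff]; omega⟩
      · exact ⟨_, .south (row ρ) (by omega) (by omega), by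
          simp only [Set.mem_insert_iff, Set.mem_singleton_iff, val_eq_iff]; exact .inl ⟨by omega, trivial⟩⟩
  · unfold IsRoot at hρ
    by_cases h1 : row ρ = 0
    · exact ⟨_, .cornerEast, by
        simp only [Set.mem_singleton_iff, val_eq_iff]; omega⟩
    · exact ⟨_, .east (n - 2 * row ρ) (by omega) (by omega) (by unfold Int.ModEq; omega), by
        simp only [Set.mem_insert_iff, Set.mem_singleton_iff, val_eq_iff]; omega⟩

theorem isBoundaryBlock_iff {S : Set (ℤ × ℤ)} :
    IsBoundaryBlock n S ↔ ∃ ρ : Vertex n, IsRoot ρ ∧ S = block ρ := by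
  refine ⟨IsBoundaryBlock.exists_eq_block, ?_⟩
  rintro ⟨ρ, hρ, rfl⟩
  obtain ⟨S, hS, hmem⟩ := hρ.exists_isBoundaryBlock
  obtain ⟨ρ', hρ', rfl⟩ := hS.exists_eq_block
  have h := (mem_block.1 hmem).2
  rw [hρ.lineRoot_eq] at h
  rwa [h]

end Blocks

section Forests

variable {n : ℕ}

/-- A parent map on the triangular array whose forest is a simplified grove: vertices point to
neighbours, except for the roots, at which every orbit ends, and boundary vertices flow to the root
of their prescribed set. -/
structure IsRooted (π : Vertex n → Vertex n) : Prop where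
  step : ∀ v, π v = v ∨ (lattice n).Adj v (π v)
  root_fixed : ∀ v, IsRoot v → π v = v
  reaches_root : ∀ v, ∃ ρ, IsRoot ρ ∧ Reaches π v ρ
  boundary : ∀ b, OnBoundary b → Reaches π b (lineRoot b)

/-- The graph that joins every vertex to its parent. -/
def forest (π : Vertex n → Vertex n) : SimpleGraph (Vertex n) where
  Adj u v := u ≠ v ∧ (π u = v ∨ π v = u)
  symm := ⟨fun _ _ h => ⟨h.1.symm, h.2.symm⟩⟩
  loopless := ⟨fun _ h => h.1 rfl⟩

theorem reachable_of_reaches {π : Vertex n → Vertex n} {u v : Vertex n} (h : Reaches π u v) :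
    (forest π).Reachable u v := by
  refine Reaches.head_induction (P := fun x => (forest π).Reachable x v) h (.refl _)
    fun x _ ih => ?_
  by_cases hx : x = π x
  · rw [hx]; exact ih
  · exact (SimpleGraph.Adj.reachable (G := forest π) ⟨hx, .inl rfl⟩).trans ih

namespace IsRooted

variable {π : Vertex n → Vertex n} (hπ : IsRooted π)
include hπ

theorem antisymm {u v : Vertex n} (h : Reaches π u v) (h' : Reaches π v u) : u = v := by
  obtain ⟨ρ, hρ, h1⟩ := hπ.reaches_root u
  exact Reaches.antisymm (hπ.root_fixed ρ hρ) h1 h h'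

theorem isRoot_of_fixed {v : Vertex n} (h : π v = v) : IsRoot v := by
  obtain ⟨ρ, hρ, h1⟩ := hπ.reaches_root v
  rwa [← Reaches.eq_of_fixed h h1]

theorem root_unique {u ρ ρ' : Vertex n} (h : Reaches π u ρ) (h' : Reaches π u ρ')
    (hρ : IsRoot ρ) (hρ' : IsRoot ρ') : ρ = ρ' :=
  Reaches.fixed_unique h h' (hπ.root_fixed _ hρ) (hπ.root_fixed _ hρ')

theorem adj_parent {v : Vertex n} (h : ¬ IsRoot v) : (lattice n).Adj v (π v) :=
  (hπ.step v).resolve_left fun h' => h (hπ.isRoot_of_fixed h')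

theorem reaches_of_reachable {u v ρ : Vertex n} (h : (forest π).Reachable u v) (hρ : IsRoot ρ)
    (hu : Reaches π u ρ) : Reaches π v ρ := by
  rw [SimpleGraph.reachable_iff_reflTransGen] at h
  induction h with
  | refl => exact hu
  | tail _ hab ih =>
    rcases hab.2 with h1 | h1
    · exact Reaches.of_fixed (.of_eq h1) ih (hπ.root_fixed _ hρ)
    · exact (Reaches.of_eq h1).trans ih

theorem isAcyclic : (forest π).IsAcyclic := by
  rw [SimpleGraph.isAcyclic_iff_forall_adj_isBridge]
  have key : ∀ u v : Vertex n, u ≠ v → π u = v → (forest π).IsBridge s(u, v) := by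
    intro u v huv h
    rw [SimpleGraph.isBridge_iff]
    intro hr
    rw [SimpleGraph.reachable_iff_reflTransGen] at hr
    have hvu : ∀ w, Relation.ReflTransGen ((forest π).deleteEdges {s(u, v)}).Adj u w →
        Reaches π w u := by
      intro w hw
      induction hw with
      | refl => exact .refl _
      | @tail a b _ hab ih =>
        rw [SimpleGraph.deleteEdges_adj] at hab
        obtain ⟨⟨hne, h1 | h1⟩, h2⟩ := hab
        · by_cases hau : a = u
          · subst hau
            rw [← h, h1] at h2
            exact absurd rfl h2
          · obtain ⟨m, hm⟩ := ih
            cases m with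
            | zero => exact absurd hm hau
            | succ m => exact ⟨m, by rw [← h1]; exact hm⟩
        · exact (Reaches.of_eq h1).trans ih
    exact huv (hπ.antisymm (.of_eq h) (hvu v hr))
  intro u v huv
  rcases huv.2 with h | h
  · exact key u v huv.1 h
  · rw [Sym2.eq_swap]; exact key v u huv.1.symm h

theorem isSimplifiedGrove : IsSimplifiedGrove n (forest π) where
  le_lattice := by
    rintro u v ⟨hne, h | h⟩
    · exact h ▸ (hπ.step u).resolve_left fun h' => hne (h'.symm.trans h)
    · exact (h ▸ (hπ.step v).resolve_left fun h' => hne (h.symm.trans h') : (lattice n).Adj v u).symm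
  acyclic := hπ.isAcyclic
  component_contains := by
    refine SimpleGraph.ConnectedComponent.ind fun v => ?_
    obtain ⟨ρ, hρ, hv⟩ := hπ.reaches_root v
    refine ⟨block ρ, ⟨isBoundaryBlock_iff.2 ⟨ρ, hρ, rfl⟩, ?_⟩, ?_⟩
    · rintro _ ⟨b, ⟨hb, rfl⟩, rfl⟩
      refine ⟨b, ?_, rfl⟩
      rw [SimpleGraph.ConnectedComponent.mem_supp_iff, SimpleGraph.ConnectedComponent.eq]
      exact (reachable_of_reaches (hπ.boundary b hb)).trans (reachable_of_reaches hv).symm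
    · rintro S ⟨hS, hSv⟩
      obtain ⟨ρ', hρ', rfl⟩ := isBoundaryBlock_iff.1 hS
      obtain ⟨w, hw, hw'⟩ := hSv hρ'.mem_block
      obtain rfl := Subtype.val_injective hw'
      rw [SimpleGraph.ConnectedComponent.mem_supp_iff, SimpleGraph.ConnectedComponent.eq] at hw
      rw [hπ.root_unique (hπ.reaches_of_reachable hw hρ' (.refl _)) hv hρ' hρ]
  contained := by
    intro S hS
    obtain ⟨ρ, hρ, rfl⟩ := isBoundaryBlock_iff.1 hS
    refine ⟨(forest π).connectedComponentMk ρ, ?_⟩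
    rintro _ ⟨b, ⟨hb, rfl⟩, rfl⟩
    refine ⟨b, ?_, rfl⟩
    rw [SimpleGraph.ConnectedComponent.mem_supp_iff, SimpleGraph.ConnectedComponent.eq]
    exact reachable_of_reaches (hπ.boundary b hb)

end IsRooted

theorem IsSimplifiedGrove.exists_forest {G : SimpleGraph (Vertex n)} (hG : IsSimplifiedGrove n G) :
    ∃ π : Vertex n → Vertex n, IsRooted π ∧ forest π = G := by
  have hblock : ∀ b, OnBoundary b → G.Reachable b (lineRoot b) := by
    intro b hb
    have hr := isRoot_lineRoot b
    obtain ⟨C, hC⟩ := hG.contained _ (isBoundaryBlock_iff.2 ⟨lineRoot b, hr, rfl⟩)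
    obtain ⟨x, hx, hx'⟩ := hC (mem_block.2 ⟨hb, rfl⟩)
    obtain ⟨y, hy, hy'⟩ := hC hr.mem_block
    obtain rfl := Subtype.val_injective hx'
    obtain rfl := Subtype.val_injective hy'
    rw [SimpleGraph.ConnectedComponent.mem_supp_iff] at hx hy
    exact SimpleGraph.ConnectedComponent.eq.1 (hx.trans hy.symm)
  have hsub : ∀ ρ, IsRoot ρ → block ρ ⊆ componentPoints (G.connectedComponentMk ρ) := by
    rintro ρ hρ _ ⟨b, ⟨hb, rfl⟩, rfl⟩
    exact ⟨b, SimpleGraph.ConnectedComponent.eq.2 (hblock b hb), rfl⟩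
  have huniq : ∀ ρ ρ', IsRoot ρ → IsRoot ρ' → G.Reachable ρ ρ' → ρ = ρ' := by
    intro ρ ρ' hρ hρ' h
    have h1 := hsub ρ' hρ'
    rw [← SimpleGraph.ConnectedComponent.eq.2 h] at h1
    have h2 := (hG.component_contains _).unique ⟨isBoundaryBlock_iff.2 ⟨ρ, hρ, rfl⟩, hsub ρ hρ⟩
      ⟨isBoundaryBlock_iff.2 ⟨ρ', hρ', rfl⟩, h1⟩
    have h3 := hρ.mem_block
    rw [h2, mem_block, hρ.lineRoot_eq] at h3
    exact h3.2
  have hroot : ∀ v, ∃ ρ, IsRoot ρ ∧ G.Reachable v ρ := by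
    intro v
    obtain ⟨S, ⟨hS, hSv⟩, -⟩ := hG.component_contains (G.connectedComponentMk v)
    obtain ⟨ρ, hρ, rfl⟩ := isBoundaryBlock_iff.1 hS
    obtain ⟨x, hx, hx'⟩ := hSv hρ.mem_block
    obtain rfl := Subtype.val_injective hx'
    exact ⟨x, hρ, (SimpleGraph.ConnectedComponent.eq.1 hx).symm⟩
  choose ρ hρ hvρ using hroot
  have hparent : ∀ v, ∃ u, (IsRoot v → u = v) ∧
      (¬ IsRoot v → G.Adj v u ∧ G.dist u (ρ v) + 1 = G.dist v (ρ v)) := by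
    intro v
    by_cases hv : IsRoot v
    · exact ⟨v, fun _ => rfl, fun h => absurd hv h⟩
    · obtain ⟨p, hp⟩ := (hvρ v).exists_walk_length_eq_dist
      have hne : v ≠ ρ v := fun h => hv (h ▸ hρ v)
      generalize hw : ρ v = w at p hp hne
      cases p with
      | nil => exact absurd rfl hne
      | @cons _ u _ h q =>
        refine ⟨u, fun h => absurd h hv, fun _ => ⟨h, ?_⟩⟩
        have h1 := SimpleGraph.dist_le q
        have h2 := SimpleGraph.dist_le (SimpleGraph.Walk.cons h q)
        have h3 : G.dist v w ≤ G.dist v u + G.dist u w :=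
          SimpleGraph.Reachable.dist_triangle_left h.reachable w
        have h4 := SimpleGraph.dist_eq_one_iff_adj.2 h
        simp only [SimpleGraph.Walk.length_cons] at hp
        omega
  choose π hπ1 hπ2 using hparent
  have hρπ : ∀ v, ρ (π v) = ρ v := by
    intro v
    by_cases hv : IsRoot v
    · rw [hπ1 v hv]
    · exact huniq _ _ (hρ _) (hρ _) (((hvρ (π v)).symm.trans (hπ2 v hv).1.reachable.symm).trans
        (hvρ v))
  have hreach : ∀ (d : ℕ) v, G.dist v (ρ v) = d → Reaches π v (ρ v) := by
    intro d
    induction d with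
    | zero =>
      intro v h
      rw [(hvρ v).dist_eq_zero_iff.1 h |>.symm]
      exact .refl _
    | succ d ih =>
      intro v h
      by_cases hv : IsRoot v
      · rw [← huniq v (ρ v) hv (hρ v) (hvρ v)]; exact .refl _
      · have h1 := ih (π v) (by rw [hρπ]; have := (hπ2 v hv).2; omega)
        rw [hρπ] at h1
        exact (Reaches.step v).trans h1
  have hle : forest π ≤ G := by
    have key : ∀ u v : Vertex n, u ≠ v → π u = v → G.Adj u v := by
      intro u v hne h
      have hu : ¬ IsRoot u := fun hu => hne ((hπ1 u hu).symm.trans h)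
      exact h ▸ (hπ2 u hu).1
    rintro u v ⟨hne, h | h⟩
    · exact key u v hne h
    · exact (key v u hne.symm h).symm
  refine ⟨π, ⟨fun v => ?_, hπ1, fun v => ⟨ρ v, hρ v, hreach _ v rfl⟩, fun b hb => ?_⟩, ?_⟩
  · by_cases hv : IsRoot v
    · exact .inl (hπ1 v hv)
    · exact .inr (hG.le_lattice (hπ2 v hv).1)
  · rw [← huniq (ρ b) _ (hρ b) (isRoot_lineRoot b) ((hvρ b).symm.trans (hblock b hb))]
    exact hreach _ b rfl
  · refine le_antisymm hle fun u v huv => ?_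
    by_contra hno
    have hbr := SimpleGraph.isAcyclic_iff_forall_adj_isBridge.1 hG.acyclic huv
    rw [SimpleGraph.isBridge_iff] at hbr
    apply hbr
    have h1 : ρ u = ρ v := huniq _ _ (hρ u) (hρ v)
      (((hvρ u).symm.trans huv.reachable).trans (hvρ v))
    have h2 : (forest π).Reachable u v :=
      (h1 ▸ reachable_of_reaches (hreach _ u rfl) : (forest π).Reachable u (ρ v)).trans
        (reachable_of_reaches (hreach _ v rfl)).symm
    refine h2.mono fun a b hab => ?_
    rw [SimpleGraph.deleteEdges_adj]
    refine ⟨hle hab, fun h => hno ?_⟩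
    rcases Sym2.eq_iff.1 h with ⟨rfl, rfl⟩ | ⟨rfl, rfl⟩
    · exact hab
    · exact hab.symm

end Forests

section Moves

variable {n : ℕ} {π : Vertex n → Vertex n} {p y : Vertex n}

namespace IsRooted

theorem reaches_of_fixed_of_reaches (hπ : IsRooted π) {u v ρ : Vertex n} (h : Reaches π u v)
    (hu : Reaches π u ρ) (hρ : IsRoot ρ) : Reaches π v ρ :=
  Reaches.of_fixed h hu (hπ.root_fixed ρ hρ)

theorem reaches_update (hy : ¬ Reaches π y p) {v ρ : Vertex n} (hv : Reaches π v ρ)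
    (h : Reaches π v p → Reaches π y ρ) : Reaches (Function.update π p y) v ρ := by
  rcases Reaches.update_or (p := p) (y := y) hv with h1 | h1
  · exact h1
  · have h2 : Reaches (Function.update π p y) y ρ :=
      Reaches.update_of_not (h (Reaches.of_update h1)) hy
    exact h1.trans ((Reaches.of_eq (Function.update_self p y π)).trans h2)

/-- Redirecting `p` to a neighbour outside of its subtree keeps the parent map rooted, if the
boundary vertices of the subtree flow to their roots from the new parent. -/
theorem update (hπ : IsRooted π) (hp : ¬ IsRoot p) (hpy : (lattice n).Adj p y)
    (hy : ¬ Reaches π y p)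
    (hb : ∀ b, OnBoundary b → Reaches π b p → Reaches π y (lineRoot b)) :
    IsRooted (Function.update π p y) where
  step v := by
    by_cases hv : v = p
    · subst hv; rw [Function.update_self]; exact .inr hpy
    · rw [Function.update_of_ne hv]; exact hπ.step v
  root_fixed v hv := by
    rw [Function.update_of_ne (fun h : v = p => hp (h ▸ hv))]; exact hπ.root_fixed v hv
  reaches_root v := by
    by_cases hv : Reaches π v p
    · obtain ⟨ρ, hρ, h⟩ := hπ.reaches_root y
      have h1 : Reaches (Function.update π p y) v p := by
        rcases Reaches.update_or (p := p) (y := y) hv with h1 | h1 <;> exact h1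
      exact ⟨ρ, hρ, h1.trans ((Reaches.of_eq (Function.update_self p y π)).trans
        (Reaches.update_of_not h hy))⟩
    · obtain ⟨ρ, hρ, h⟩ := hπ.reaches_root v
      exact ⟨ρ, hρ, Reaches.update_of_not h hv⟩
  boundary b h := reaches_update hy (hπ.boundary b h) (hb b h)

/-- The same redirection is a spin if the new parent is a neighbour of the old one. -/
theorem groveSpin_update (hπ : IsRooted π) (hp : ¬ IsRoot p) (hpy : (lattice n).Adj p y)
    (hqy : (lattice n).Adj (π p) y) (hy : ¬ Reaches π y p)
    (hb : ∀ b, OnBoundary b → Reaches π b p → Reaches π y (lineRoot b)) :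
    GroveSpin n (forest π) (forest (Function.update π p y)) := by
  have hpq := hπ.adj_parent hp
  have hqp : π (π p) ≠ p := fun h => hpq.ne (hπ.antisymm (.step p) (.of_eq h))
  refine ⟨hπ.isSimplifiedGrove, (hπ.update hp hpy hy hb).isSimplifiedGrove, p, π p, y, hpq, hpy,
    hqy, ⟨hpq.ne, .inl rfl⟩, ?_, ?_⟩
  · rintro ⟨-, h | h⟩
    · exact hqy.ne h
    · exact hy (.of_eq h)
  · ext e
    induction e using Sym2.ind with
    | _ u v =>
      simp only [SimpleGraph.mem_edgeSet, Set.mem_union, Set.mem_sdiff, Set.mem_singleton_iff,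
        Sym2.eq_iff, forest]
      by_cases hu : u = p
      · subst hu
        by_cases hv : v = u
        · subst hv
          simp [hpq.ne, hpy.ne]
        · rw [Function.update_self, Function.update_of_ne hv]
          have h1 : π v = u → v ≠ π u := fun h h' => hqp (h' ▸ h)
          have := hpy.ne
          grind
      · by_cases hv : v = p
        · subst hv
          rw [Function.update_self, Function.update_of_ne hu]
          have h1 : π u = v → u ≠ π v := fun h h' => hqp (h' ▸ h)
          have := hpy.ne
          grind
        · rw [Function.update_of_ne hu, Function.update_of_ne hv]
          simp [hu, hv]

end IsRooted

/-- `π'` is a parent map of a grove obtained by spins from that of `π`, and `π'` agrees with `π`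
on `F`. -/
structure SpinsTo (F : Set (Vertex n)) (π π' : Vertex n → Vertex n) : Prop where
  rooted : IsRooted π'
  spins : Relation.ReflTransGen (GroveSpin n) (forest π) (forest π')
  eqOn : Set.EqOn π' π F

theorem SpinsTo.refl {F : Set (Vertex n)} (hπ : IsRooted π) : SpinsTo F π π :=
  ⟨hπ, .refl, fun _ _ => rfl⟩

theorem SpinsTo.trans {F : Set (Vertex n)} {π₁ π₂ π₃ : Vertex n → Vertex n}
    (h : SpinsTo F π₁ π₂) (h' : SpinsTo F π₂ π₃) : SpinsTo F π₁ π₃ :=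
  ⟨h'.rooted, h.spins.trans h'.spins, fun _ hv => (h'.eqOn hv).trans (h.eqOn hv)⟩

theorem IsRooted.spinsTo_update {F : Set (Vertex n)} (hπ : IsRooted π) (hp : ¬ IsRoot p)
    (hpF : p ∉ F) (hpy : (lattice n).Adj p y) (hqy : (lattice n).Adj (π p) y)
    (hy : ¬ Reaches π y p)
    (hb : ∀ b, OnBoundary b → Reaches π b p → Reaches π y (lineRoot b)) :
    SpinsTo F π (Function.update π p y) :=
  ⟨hπ.update hp hpy hy hb, .single (hπ.groveSpin_update hp hpy hqy hy hb),
    fun v hv => Function.update_of_ne (fun h : v = p => hpF (h ▸ hv)) _ _⟩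

theorem not_reaches_of_mem {F : Set (Vertex n)} (hF : ∀ v ∈ F, π v ∈ F) {x : Vertex n} (hx : x ∈ F)
    (hp : p ∉ F) : ¬ Reaches π x p := by
  rintro ⟨m, hm⟩
  have : ∀ m, π^[m] x ∈ F := by
    intro m
    induction m with
    | zero => exact hx
    | succ m ih => rw [Function.iterate_succ_apply']; exact hF _ ih
  exact hp (hm ▸ this m)

/-- A leaf that is not on the boundary can be rotated freely. -/
theorem IsRooted.spinsTo_update_leaf {F : Set (Vertex n)} (hπ : IsRooted π) (hp : ¬ IsRoot p)
    (hpF : p ∉ F) (hpB : ¬ OnBoundary p) (hleaf : ∀ v, π v ≠ p)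
    (hpy : (lattice n).Adj p y) (hqy : (lattice n).Adj (π p) y) :
    SpinsTo F π (Function.update π p y) := by
  have key : ∀ v, Reaches π v p → v = p := by
    rintro v ⟨m, hm⟩
    cases m with
    | zero => exact hm
    | succ m =>
      rw [Function.iterate_succ_apply'] at hm
      exact absurd hm (hleaf _)
  exact hπ.spinsTo_update hp hpF hpy hqy (fun h => hpy.ne (key _ h).symm)
    fun b hb h => absurd (key b h ▸ hb) hpB

theorem leaf_update (hleaf : ∀ v, π v ≠ p) (hy : y ≠ p) :
    ∀ v, Function.update π p y v ≠ p := by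
  intro v
  by_cases hv : v = p
  · subst hv; rwa [Function.update_self]
  · rw [Function.update_of_ne hv]; exact hleaf v

/-- The local step: the interior vertex `p`, with neighbours `e, ne, nw, w, sw, se` in cyclic order,
can be redirected to `e` if `e`, `se` and `sw` have been dealt with already. -/
theorem IsRooted.exists_spinsTo_interior {F : Set (Vertex n)} (hπ : IsRooted π)
    (hF : ∀ v ∈ F, π v ∈ F) {e ne nw w sw se : Vertex n} (hp : ¬ IsRoot p) (hpF : p ∉ F)
    (hpB : ¬ OnBoundary p) (heF : e ∈ F) (hswF : sw ∈ F) (hseF : se ∈ F)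
    (hroot : ∀ v, IsRoot v → v ∈ F)
    (hnbr : ∀ x, (lattice n).Adj p x ↔ x = e ∨ x = ne ∨ x = nw ∨ x = w ∨ x = sw ∨ x = se)
    (h1 : (lattice n).Adj e ne) (h2 : (lattice n).Adj ne nw) (h3 : (lattice n).Adj nw w)
    (h5 : (lattice n).Adj sw se) (h6 : (lattice n).Adj se e)
    (hb : ∀ b, OnBoundary b → Reaches π b p → Reaches π e (lineRoot b))
    (hsw : π p = sw → ∀ b, OnBoundary b → ¬ Reaches π b p) :
    ∃ π', SpinsTo F π π' ∧ π' p = e := by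
  have ae : (lattice n).Adj p e := (hnbr e).2 (by simp)
  have ane : (lattice n).Adj p ne := (hnbr ne).2 (by simp)
  have anw : (lattice n).Adj p nw := (hnbr nw).2 (by simp)
  have aw : (lattice n).Adj p w := (hnbr w).2 (by simp)
  have ase : (lattice n).Adj p se := (hnbr se).2 (by simp)
  have direct : (lattice n).Adj (π p) e → ∃ π', SpinsTo F π π' ∧ π' p = e := fun h =>
    ⟨_, hπ.spinsTo_update hp hpF ae h (not_reaches_of_mem hF heF hpF) hb,
      Function.update_self _ _ _⟩
  have notF {σ : Vertex n → Vertex n} (hσ : Set.EqOn σ π F) {v : Vertex n} (hv : σ v = p) : v ∉ F :=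
    fun hvF => hpF (hv ▸ (hσ hvF) ▸ hF v hvF)
  have main : π p = nw ∨ π p = w → ∃ π', SpinsTo F π π' ∧ π' p = e := by
    intro hcase
    obtain ⟨σ, hσ, hσp, hσne⟩ : ∃ σ, SpinsTo F π σ ∧ σ p = π p ∧ σ ne ≠ p := by
      by_cases hne : π ne = p
      · have hneF := notF (fun _ _ => rfl) hne
        refine ⟨Function.update π ne e, hπ.spinsTo_update (fun h => hneF (hroot _ h)) hneF h1.symm
          (hne ▸ ae) (not_reaches_of_mem hF heF hneF)
          fun b hbB h => hb b hbB (h.trans (.of_eq hne)), ?_, ?_⟩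
        · exact Function.update_of_ne ane.ne _ _
        · rw [Function.update_self]; exact ae.ne'
      · exact ⟨π, .refl hπ, rfl, hne⟩
    have reach : ∀ {x z}, σ x = p → σ p = z → ∀ b, OnBoundary b → Reaches σ b x →
        Reaches σ z (lineRoot b) := fun hx hz b hbB h =>
      hσ.rooted.reaches_of_fixed_of_reaches ((h.trans (.of_eq hx)).trans (.of_eq hz))
        (hσ.rooted.boundary b hbB) (isRoot_lineRoot b)
    have cut : ∀ {x z}, σ x = p → σ p = z → (lattice n).Adj x z →
        ¬ Reaches σ z x := fun hx hz hxz h =>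
      hxz.ne (hσ.rooted.antisymm ((Reaches.of_eq hx).trans (.of_eq hz)) h)
    obtain ⟨τ, hτ, hτp, hleaf⟩ : ∃ τ, SpinsTo F π τ ∧ τ p = π p ∧ ∀ v, τ v ≠ p := by
      have leaf : ∀ τ : Vertex n → Vertex n, SpinsTo F π τ → τ ne ≠ p → τ nw ≠ p → τ w ≠ p →
          ∀ v, τ v ≠ p := by
        intro τ hτ t1 t2 t3 v hv
        have hvF := notF hτ.eqOn hv
        have hav := hτ.rooted.adj_parent fun h => hvF (hroot _ h)
        rw [hv] at hav
        rcases (hnbr v).1 hav.symm with rfl | rfl | rfl | rfl | rfl | rfl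
        · exact hvF heF
        · exact t1 hv
        · exact t2 hv
        · exact t3 hv
        · exact hvF hswF
        · exact hvF hseF
      rcases hcase with hpn | hpw
      · have hnw : σ nw ≠ p := fun h =>
          anw.ne (hσ.rooted.antisymm (.of_eq (hσp.trans hpn)) (.of_eq h))
        by_cases hw : σ w = p
        · have hwF := notF hσ.eqOn hw
          have hs : SpinsTo F σ (Function.update σ w nw) :=
            hσ.rooted.spinsTo_update (fun h => hwF (hroot _ h)) hwF h3.symm
              (hw.symm ▸ anw) (cut hw (hσp.trans hpn) h3.symm) (reach hw (hσp.trans hpn))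
          have hx := hσ.trans hs
          have hp' : Function.update σ w nw p = π p := by
            rw [Function.update_of_ne aw.ne, hσp]
          refine ⟨_, hx, hp', leaf _ hx ?_ ?_ ?_⟩
          · by_cases h : ne = w
            · rw [h, Function.update_self]; exact anw.ne'
            · rwa [Function.update_of_ne h]
          · rwa [Function.update_of_ne h3.ne]
          · rw [Function.update_self]; exact anw.ne'
        · exact ⟨σ, hσ, hσp, leaf σ hσ hσne hnw hw⟩
      · have hw : σ w ≠ p := fun h =>
          aw.ne (hσ.rooted.antisymm (.of_eq (hσp.trans hpw)) (.of_eq h))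
        by_cases hnw : σ nw = p
        · have hnwF := notF hσ.eqOn hnw
          have hs : SpinsTo F σ (Function.update σ nw w) :=
            hσ.rooted.spinsTo_update (fun h => hnwF (hroot _ h)) hnwF h3
              (hnw.symm ▸ aw) (cut hnw (hσp.trans hpw) h3) (reach hnw (hσp.trans hpw))
          have hx := hσ.trans hs
          have hp' : Function.update σ nw w p = π p := by
            rw [Function.update_of_ne anw.ne, hσp]
          refine ⟨_, hx, hp', leaf _ hx ?_ ?_ ?_⟩
          · rwa [Function.update_of_ne h2.ne]
          · rw [Function.update_self]; exact aw.ne'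
          · rwa [Function.update_of_ne h3.ne']
        · exact ⟨σ, hσ, hσp, leaf σ hσ hσne hnw hw⟩
    have fromNw : ∀ τ : Vertex n → Vertex n, SpinsTo F π τ → τ p = nw → (∀ v, τ v ≠ p) →
        ∃ π', SpinsTo F π π' ∧ π' p = e := by
      intro τ hτ hτp hleaf
      have s1 : SpinsTo F τ (Function.update τ p ne) :=
        hτ.rooted.spinsTo_update_leaf hp hpF hpB hleaf ane (hτp ▸ h2.symm)
      have s2 : SpinsTo F _ (Function.update (Function.update τ p ne) p e) :=
        s1.rooted.spinsTo_update_leaf hp hpF hpB (leaf_update hleaf ane.ne') ae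
          (by rw [Function.update_self]; exact h1.symm)
      exact ⟨_, (hτ.trans s1).trans s2, Function.update_self _ _ _⟩
    rcases hcase with hpn | hpw
    · exact fromNw τ hτ (hτp.trans hpn) hleaf
    · have s1 : SpinsTo F τ (Function.update τ p nw) :=
        hτ.rooted.spinsTo_update_leaf hp hpF hpB hleaf anw (by rw [hτp, hpw]; exact h3.symm)
      exact fromNw _ (hτ.trans s1) (Function.update_self _ _ _) (leaf_update hleaf anw.ne')
  rcases (hnbr (π p)).1 (hπ.adj_parent hp) with h | h | h | h | h | h
  · exact ⟨π, .refl hπ, h⟩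
  · exact direct (h ▸ h1.symm)
  · exact main (.inl h)
  · exact main (.inr h)
  · have hno := hsw h
    have s1 : SpinsTo F π (Function.update π p se) :=
      hπ.spinsTo_update hp hpF ase (h ▸ h5) (not_reaches_of_mem hF hseF hpF)
        fun b hbB hr => absurd hr (hno b hbB)
    have hF1 : ∀ v ∈ F, Function.update π p se v ∈ F := fun v hv => by
      rw [s1.eqOn hv]; exact hF v hv
    have s2 : SpinsTo F _ (Function.update (Function.update π p se) p e) :=
      s1.rooted.spinsTo_update hp hpF ae (by rw [Function.update_self]; exact h6)
        (not_reaches_of_mem hF1 heF hpF) fun b hbB hr => absurd (Reaches.of_update hr) (hno b hbB)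
    exact ⟨_, s1.trans s2, Function.update_self _ _ _⟩
  · exact direct (h ▸ h6)

end Moves

section Crossing

variable {n : ℕ}

/-- The signed crossing of the step from `a` to `a'` with the ray that starts just below the vertex
`d` and runs to the right. -/
def crossing (d a a' : Vertex n) : ℤ :=
  if row a = row d ∧ row a' = row d + 1 ∧ col d < col a then 1
  else if row a' = row d ∧ row a = row d + 1 ∧ col d < col a' then -1 else 0

/-- The indicator of the points in the row of `d` to the right of `d`. -/
def rightOf (d a : Vertex n) : ℤ := if row a = row d ∧ col d < col a then 1 else 0

theorem crossing_of_row_eq {d d' a a' : Vertex n} (hd : (lattice n).Adj d d')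
    (hrow : row d' = row d) (h1 : a ≠ d) (h2 : a ≠ d') (h3 : a' ≠ d) (h4 : a' ≠ d') :
    crossing d' a a' = crossing d a a' := by
  rw [lattice_adj_iff] at hd
  have e1 : ¬ (col a = col d ∧ row a = row d) := fun h => h1 (vertex_ext h.1 h.2)
  have e2 : ¬ (col a = col d' ∧ row a = row d') := fun h => h2 (vertex_ext h.1 h.2)
  have e3 : ¬ (col a' = col d ∧ row a' = row d) := fun h => h3 (vertex_ext h.1 h.2)
  have e4 : ¬ (col a' = col d' ∧ row a' = row d') := fun h => h4 (vertex_ext h.1 h.2)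
  unfold crossing
  split_ifs <;> omega

theorem crossing_of_row_succ {d d' a a' : Vertex n} (hd : (lattice n).Adj d d')
    (hrow : row d' = row d + 1) (ha : a' = a ∨ (lattice n).Adj a a')
    (h1 : a ≠ d) (h2 : a ≠ d') (h3 : a' ≠ d) (h4 : a' ≠ d') :
    crossing d' a a' - crossing d a a' = rightOf d' a - rightOf d' a' := by
  have e1 : ¬ (col a = col d ∧ row a = row d) := fun h => h1 (vertex_ext h.1 h.2)
  have e2 : ¬ (col a = col d' ∧ row a = row d') := fun h => h2 (vertex_ext h.1 h.2)
  have e3 : ¬ (col a' = col d ∧ row a' = row d) := fun h => h3 (vertex_ext h.1 h.2)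
  have e4 : ¬ (col a' = col d' ∧ row a' = row d') := fun h => h4 (vertex_ext h.1 h.2)
  rw [lattice_adj_iff] at hd
  rcases ha with rfl | ha
  · unfold crossing rightOf
    split_ifs <;> omega
  rw [lattice_adj_iff] at ha
  unfold crossing rightOf
  rcases ha with ha | ha | ha <;> split_ifs <;> omega

theorem crossing_of_col_eq_zero {d a a' : Vertex n} (hd : col d = 0)
    (ha : a' = a ∨ (lattice n).Adj a a') (h1 : a ≠ d) (h3 : a' ≠ d) :
    crossing d a a' = (if row a ≤ row d then 1 else 0) - (if row a' ≤ row d then 1 else 0) := by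
  have e1 : ¬ (col a = col d ∧ row a = row d) := fun h => h1 (vertex_ext h.1 h.2)
  have e3 : ¬ (col a' = col d ∧ row a' = row d) := fun h => h3 (vertex_ext h.1 h.2)
  have := coords a
  have := coords a'
  unfold crossing
  rcases ha with rfl | ha
  · split_ifs <;> omega
  rw [lattice_adj_iff] at ha
  split_ifs <;> omega

theorem crossing_of_hypotenuse {d a a' : Vertex n} (hd : col d + row d = n) :
    crossing d a a' = 0 := by
  have := coords a
  have := coords a'
  unfold crossing
  split_ifs <;> omega

/-- The indicator of the points at or below the level of `a`, for a point `a` in the interior of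
the right-hand side; zero for the points of the other sides. -/
def belowRight (a d : Vertex n) : ℤ :=
  if col a ≠ 0 ∧ row a ≠ 0 ∧ row a ≤ row d then 1 else 0

theorem rightOf_eq {a d d' : Vertex n} (ha : OnBoundary a) (hrow : row d' = row d + 1)
    (h2 : a ≠ d') : rightOf d' a = belowRight a d' - belowRight a d := by
  have e2 : ¬ (col a = col d' ∧ row a = row d') := fun h => h2 (vertex_ext h.1 h.2)
  have := coords a
  have := coords d
  have := coords d'
  unfold OnBoundary at ha
  unfold rightOf belowRight
  split_ifs <;> omega

/-- The number of crossings of a walk with the ray from `d`, corrected so as to be constant on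
regions which the walk does not meet. -/
def sideOf (A : ℕ → Vertex n) (s : ℕ) (d : Vertex n) : ℤ :=
  (∑ i ∈ Finset.range s, crossing d (A i) (A (i + 1))) - belowRight (A 0) d + belowRight (A s) d

variable {A : ℕ → Vertex n} {s : ℕ}

theorem sideOf_of_adj (hA : ∀ i, A (i + 1) = A i ∨ (lattice n).Adj (A i) (A (i + 1)))
    (h0 : OnBoundary (A 0)) (hs : OnBoundary (A s)) {d d' : Vertex n}
    (hadj : (lattice n).Adj d d') (hd : ∀ i, A i ≠ d) (hd' : ∀ i, A i ≠ d') :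
    sideOf A s d = sideOf A s d' := by
  have key : ∀ d d' : Vertex n, (lattice n).Adj d d' → (∀ i, A i ≠ d) → (∀ i, A i ≠ d') →
      row d' = row d + 1 → sideOf A s d = sideOf A s d' := by
    intro d d' hadj hd hd' hrow
    have h1 : ∑ i ∈ Finset.range s, crossing d' (A i) (A (i + 1)) -
        ∑ i ∈ Finset.range s, crossing d (A i) (A (i + 1)) =
        rightOf d' (A 0) - rightOf d' (A s) := by
      rw [← Finset.sum_sub_distrib, ← Finset.sum_range_sub' (fun i => rightOf d' (A i))]
      exact Finset.sum_congr rfl fun i _ => crossing_of_row_succ hadj hrow (hA i) (hd i) (hd' i)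
        (hd _) (hd' _)
    have h2 := rightOf_eq h0 hrow (hd' 0)
    have h3 := rightOf_eq hs hrow (hd' s)
    unfold sideOf
    omega
  have hcases := lattice_adj_iff.1 hadj
  rcases hcases with h | h | h
  · have h1 : ∑ i ∈ Finset.range s, crossing d' (A i) (A (i + 1)) =
        ∑ i ∈ Finset.range s, crossing d (A i) (A (i + 1)) :=
      Finset.sum_congr rfl fun i _ => crossing_of_row_eq hadj h.1 (hd i) (hd' i) (hd _) (hd' _)
    unfold sideOf belowRight
    rw [h1, h.1]
  · exact key d d' hadj hd hd' h.1
  · exact (key d' d hadj.symm hd' hd (by omega)).symm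

theorem sideOf_of_hypotenuse {d : Vertex n} (hd : col d + row d = n) :
    sideOf A s d = belowRight (A s) d - belowRight (A 0) d := by
  unfold sideOf
  rw [Finset.sum_eq_zero fun i _ => crossing_of_hypotenuse hd]
  omega

theorem sideOf_of_col_eq_zero (hA : ∀ i, A (i + 1) = A i ∨ (lattice n).Adj (A i) (A (i + 1)))
    {d : Vertex n} (hd : col d = 0) (hd' : ∀ i, A i ≠ d) :
    sideOf A s d = ((if row (A 0) ≤ row d then 1 else 0) - belowRight (A 0) d) -
      ((if row (A s) ≤ row d then 1 else 0) - belowRight (A s) d) := by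
  unfold sideOf
  rw [Finset.sum_congr rfl fun i _ => crossing_of_col_eq_zero hd (hA i) (hd' i) (hd' (i + 1)),
    Finset.sum_range_sub' (fun i => if row (A i) ≤ row d then (1 : ℤ) else 0)]
  omega

end Crossing

section Processing

variable {n : ℕ}

/-- The index of the line of the target grove that carries the vertex. -/
def level (v : Vertex n) : ℤ := max (col v) (row v)

/-- The position of a vertex among those of its level, counted from the root. -/
def pos (v : Vertex n) : ℤ :=
  if col v ≤ row v then col v else if 2 * col v ≤ n then 2 * col v - row v
  else 2 * n - col v - row v

/-- The order in which the vertices are dealt with. -/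
def Before (u v : Vertex n) : Prop := level v < level u ∨ (level u = level v ∧ pos u < pos v)

theorem level_pos_cases (v : Vertex n) :
    (col v ≤ row v ∧ level v = row v ∧ pos v = col v) ∨
    (row v < col v ∧ level v = col v ∧ 2 * col v ≤ n ∧ pos v = 2 * col v - row v) ∨
    (row v < col v ∧ level v = col v ∧ (n : ℤ) < 2 * col v ∧ pos v = 2 * n - col v - row v) := by
  unfold level pos
  split_ifs <;> omega

theorem level_pos_injective {u v : Vertex n} (h : level u = level v) (h' : pos u = pos v) :
    u = v := by
  have := level_pos_cases u
  have := level_pos_cases v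
  have := coords u
  have := coords v
  apply vertex_ext <;> omega

theorem before_next {v : Vertex n} (hv : ¬ IsRoot v) : Before (next v) v := by
  have h0 := coords v
  have h1 := level_pos_cases v
  have h2 := level_pos_cases (next v)
  unfold Before
  rcases next_coords v with h | h | h
  · exact absurd h.1 hv
  · omega
  · omega

theorem Before.trans {u v w : Vertex n} (h : Before u v) (h' : Before v w) : Before u w := by
  unfold Before at *
  omega

theorem Before.irrefl (v : Vertex n) : ¬ Before v v := by
  unfold Before
  omega

variable {π : Vertex n → Vertex n} {p : Vertex n}

/-- The vertices dealt with before `p`, and the roots. -/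
def done (p : Vertex n) : Set (Vertex n) := {v | Before v p ∨ IsRoot v}

theorem IsRooted.eq_next_of_done (hπ : IsRooted π) (h : ∀ v, Before v p → π v = next v)
    {v : Vertex n} (hv : v ∈ done p) : π v = next v := by
  rcases next_coords v with h1 | h1
  · rw [h1.2, hπ.root_fixed v h1.1]
  · exact h v (hv.resolve_right (by tauto))

theorem IsRooted.mapsTo_done (hπ : IsRooted π) (h : ∀ v, Before v p → π v = next v) :
    ∀ v ∈ done p, π v ∈ done p := by
  intro v hv
  rw [hπ.eq_next_of_done h hv]
  by_cases hr : IsRoot v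
  · rcases next_coords v with h1 | h1
    · rw [h1.2]; exact .inr hr
    · tauto
  · exact .inl ((before_next hr).trans (hv.resolve_right hr))

theorem IsRooted.reaches_lineRoot_of_done (hπ : IsRooted π) (h : ∀ v, Before v p → π v = next v)
    {v : Vertex n} (hv : v ∈ done p) : Reaches π v (lineRoot v) := by
  obtain ⟨ρ, hρ, hr⟩ := hπ.reaches_root v
  have : v ∈ done p → lineRoot v = ρ := by
    refine Reaches.head_induction (P := fun x => x ∈ done p → lineRoot x = ρ) hr
      (fun _ => hρ.lineRoot_eq) fun x _ ih hx => ?_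
    rw [← ih (hπ.mapsTo_done h x hx), hπ.eq_next_of_done h hx, lineRoot_next]
  rwa [this hv]

theorem level_lineRoot (v : Vertex n) : level (lineRoot v) = level v := by
  have := lineRoot_coords v
  have := coords v
  unfold level
  omega

theorem sideOf_eq_of_reaches (hπ : IsRooted π) {A : ℕ → Vertex n} {s : ℕ}
    (hA : ∀ i, A (i + 1) = A i ∨ (lattice n).Adj (A i) (A (i + 1)))
    (h0 : OnBoundary (A 0)) (hs : OnBoundary (A s)) {u ρ : Vertex n} (h : Reaches π u ρ)
    (hd : ∀ x, Reaches π x ρ → ∀ i, A i ≠ x) : sideOf A s u = sideOf A s ρ := by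
  refine Reaches.head_induction (P := fun x => sideOf A s x = sideOf A s ρ) h rfl
    fun x hx ih => ?_
  rw [← ih]
  rcases hπ.step x with h1 | h1
  · rw [h1]
  · exact sideOf_of_adj hA h0 hs h1 (hd x ((Reaches.step x).trans hx)) (hd _ hx)

/-- The far end of the target line through `p`. -/
theorem exists_lineStart (p : Vertex n) (hp : ¬ IsRoot p) :
    ∃ q : Vertex n, OnBoundary q ∧ lineRoot q = lineRoot p ∧
      ((row p < col p ∨ 2 * row p ≤ n) ∧ row q = 0 ∨
        (col p ≤ row p ∧ (n : ℤ) < 2 * row p ∧ col q ≠ 0 ∧ row q = row p)) := by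
  have h0 := coords p
  have hl := lineRoot_coords p
  unfold IsRoot at hp
  by_cases h : row p < col p ∨ 2 * row p ≤ n
  · have hq := @pt_coords n (max (col p) (row p)) 0 (by omega)
    have hlq := lineRoot_coords (pt n (max (col p) (row p)) 0)
    refine ⟨pt n (max (col p) (row p)) 0, .inr (.inl hq.2), ?_, .inl ⟨h, hq.2⟩⟩
    apply vertex_ext <;> omega
  · have hq := @pt_coords n (n - row p) (row p) (by omega)
    have hlq := lineRoot_coords (pt n (n - row p) (row p))
    refine ⟨pt n (n - row p) (row p), .inr (.inr (by omega)), ?_, .inr (by omega)⟩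
    apply vertex_ext <;> omega

/-- A straight walk outwards from `p` ends on the right-hand side of the triangle. -/
theorem exists_hypotenuse {P : Vertex n → Prop} (p : Vertex n) (hp : P p)
    (ih : ∀ x y, P x → (lattice n).Adj x y → level p ≤ level x → level p < level y → P y) :
    ∃ d, P d ∧ col d + row d = n ∧
      (col p ≤ row p ∧ col d = col p ∨ row p < col p ∧ row d = row p) := by
  have h0 := coords p
  have key : ∀ t : ℕ, ∀ x : Vertex n, P x → level p ≤ level x → n - col x - row x = t →
      (col p ≤ row p ∧ row p ≤ row x ∧ col x = col p ∨
        row p < col p ∧ col p ≤ col x ∧ row x = row p) →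
      ∃ d, P d ∧ col d + row d = n ∧
      (col p ≤ row p ∧ col d = col p ∨ row p < col p ∧ row d = row p) := by
    intro t
    induction t with
    | zero => exact fun x hx _ ht hc => ⟨x, hx, by omega, by omega⟩
    | succ t IH =>
      intro x hx hl ht hc
      have hx0 := coords x
      rcases hc with hc | hc
      · have hy := @pt_coords n (col x) (row x + 1) (by omega)
        have hl' : level p < level (pt n (col x) (row x + 1)) := by unfold level; omega
        exact IH _ (ih x _ hx (by rw [lattice_adj_iff]; omega) hl hl') hl'.le (by omega) (by omega)
      · have hy := @pt_coords n (col x + 1) (row x) (by omega)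
        have hl' : level p < level (pt n (col x + 1) (row x)) := by unfold level; omega
        exact IH _ (ih x _ hx (by rw [lattice_adj_iff]; omega) hl hl') hl'.le (by omega) (by omega)
  exact key (n - col p - row p).toNat p hp le_rfl (by omega) (by omega)

set_option maxHeartbeats 1000000 in
/-- Planarity: the boundary vertices that flow through `p` belong to the line of `p`. -/
theorem IsRooted.lineRoot_eq_of_reaches (hπ : IsRooted π)
    (h : ∀ v, Before v p → π v = next v) (hp : ¬ IsRoot p) {b : Vertex n} (hb : OnBoundary b)
    (hbp : Reaches π b p) (hpB : ¬ OnBoundary p) : lineRoot b = lineRoot p := by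
  by_contra hne
  have hpF : p ∉ done p := by
    rintro (h1 | h1)
    · exact Before.irrefl p h1
    · exact hp h1
  have hbF : b ∉ done p := fun hbF => not_reaches_of_mem (hπ.mapsTo_done h) hbF hpF hbp
  have hlevel : level (lineRoot b) ≤ level (lineRoot p) := by
    rw [level_lineRoot, level_lineRoot]
    by_contra hlt
    exact hbF (.inl (.inl (by omega)))
  obtain ⟨q, hqB, hq, hqc⟩ := exists_lineStart p hp
  obtain ⟨s, hs⟩ : Reaches π q (lineRoot p) := hq ▸ hπ.boundary q hqB
  have hρ := isRoot_lineRoot p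
  have hρ' := isRoot_lineRoot b
  set A : ℕ → Vertex n := fun i => π^[i] q with hAdef
  have hA : ∀ i, A (i + 1) = A i ∨ (lattice n).Adj (A i) (A (i + 1)) := by
    intro i
    simp only [hAdef, Function.iterate_succ_apply']
    exact hπ.step _
  have hAs : A s = lineRoot p := hs
  have hoff : ∀ x ρ, IsRoot ρ → ρ ≠ lineRoot p → Reaches π x ρ → ∀ i, A i ≠ x := by
    rintro x ρ h1 h2 h3 i rfl
    exact h2 (hπ.root_unique h3 (hπ.reaches_of_fixed_of_reaches ⟨i, rfl⟩ ⟨s, hs⟩ hρ) h1 hρ)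
  have hpρ' : Reaches π p (lineRoot b) :=
    hπ.reaches_of_fixed_of_reaches hbp (hπ.boundary b hb) hρ'
  have hAsB : OnBoundary (A s) := hAs ▸ hρ.onBoundary
  have h1 : sideOf A s p = sideOf A s (lineRoot b) :=
    sideOf_eq_of_reaches hπ hA hqB hAsB hpρ' fun x hx => hoff x _ hρ' hne hx
  obtain ⟨d, ⟨hd, -⟩, hdh, hdc⟩ := exists_hypotenuse (P := fun x =>
      sideOf A s x = sideOf A s (lineRoot b) ∧ ∀ i, A i ≠ x) p ⟨h1, hoff p _ hρ' hne hpρ'⟩ (by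
    intro x y hx hxy hlx hly
    have hy : ∀ i, A i ≠ y := by
      refine hoff y _ (isRoot_lineRoot y) (fun h' => ?_)
        (hπ.reaches_lineRoot_of_done h (.inl (.inl hly)))
      rw [← level_lineRoot p, ← level_lineRoot y, h'] at hly
      exact lt_irrefl _ hly
    exact ⟨(sideOf_of_adj hA hqB hAsB hxy hx.2 hy).symm.trans hx.1, hy⟩)
  have hne' : ¬ (col (lineRoot b) = col (lineRoot p) ∧ row (lineRoot b) = row (lineRoot p)) :=
    fun h' => hne (vertex_ext h'.1 h'.2)
  have hA0 : A 0 = q := rfl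
  have c1 := lineRoot_coords p
  have c2 := coords p
  have c3 := coords (lineRoot b)
  unfold OnBoundary at hpB
  rw [sideOf_of_hypotenuse hdh, hAs, hA0] at hd
  unfold level at hlevel
  rcases id hρ' with h2 | h2
  · rw [sideOf_of_col_eq_zero hA h2 (hoff _ _ hρ' hne (.refl _)), hAs, hA0] at hd
    clear hpρ' hoff hAsB h1 hA hs hq hρ hbF hpF hne hbp
    unfold belowRight at hd
    split_ifs at hd <;> omega
  · rw [sideOf_of_hypotenuse h2.2, hAs, hA0] at hd
    unfold belowRight at hd
    split_ifs at hd <;> omega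

end Processing

section Connectivity

variable {n : ℕ} {π : Vertex n → Vertex n} {p : Vertex n}

theorem IsRooted.exists_spinsTo_boundary (hπ : IsRooted π)
    (h : ∀ v, Before v p → π v = next v) (hp : ¬ IsRoot p) (hpB : OnBoundary p) :
    ∃ π', SpinsTo (done p) π π' ∧ π' p = next p := by
  have hpF : p ∉ done p := fun h1 => h1.elim (Before.irrefl p) hp
  have hadj := hπ.adj_parent hp
  have hreach := hπ.boundary p hpB
  have heF : next p ∈ done p := .inl (before_next hp)
  have hx : OnBoundary (π p) → lineRoot (π p) = lineRoot p := fun hx =>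
    hπ.root_unique ((Reaches.step p).trans (hπ.boundary _ hx)) hreach (isRoot_lineRoot _)
      (isRoot_lineRoot p)
  have hx' : OnBoundary (π p) → col (lineRoot (π p)) = col (lineRoot p) ∧
      row (lineRoot (π p)) = row (lineRoot p) := fun h1 => by rw [hx h1]; exact ⟨rfl, rfl⟩
  have hape : (lattice n).Adj p (next p) := by
    rw [lattice_adj_iff]
    rcases next_coords p with h1 | h1 | h1
    · exact absurd h1.1 hp
    all_goals omega
  have hcase : π p = next p ∨ (lattice n).Adj (π p) (next p) := by
    by_cases heq : π p = next p
    · exact .inl heq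
    · right
      have hne : ¬ (col (π p) = col (next p) ∧ row (π p) = row (next p)) :=
        fun h1 => heq (vertex_ext h1.1 h1.2)
      have h1 := next_coords p
      have h2 := coords p
      have h3 := coords (π p)
      have h4 := lineRoot_coords p
      have h5 := lineRoot_coords (π p)
      rw [lattice_adj_iff] at hadj ⊢
      unfold OnBoundary at hx' hpB
      rcases h1 with h1 | h1 | h1
      · exact absurd h1.1 hp
      all_goals
        by_cases h6 : col (π p) = 0 ∨ row (π p) = 0 ∨ col (π p) + row (π p) = n
        · have := hx' h6
          rcases hadj with hadj | hadj | hadj <;> omega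
        · clear hx' h4 h5
          rcases hadj with hadj | hadj | hadj <;> omega
  rcases hcase with heq | hqe
  · exact ⟨π, .refl hπ, heq⟩
  · refine ⟨_, hπ.spinsTo_update hp hpF hape hqe (not_reaches_of_mem (hπ.mapsTo_done h) heF hpF)
      fun b hb hbp => ?_, Function.update_self _ _ _⟩
    have h1 : lineRoot b = lineRoot (next p) := by
      rw [lineRoot_next]
      exact hπ.root_unique (hπ.boundary b hb) (hbp.trans hreach) (isRoot_lineRoot _)
        (isRoot_lineRoot p)
    rw [h1]
    exact hπ.reaches_lineRoot_of_done h heF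

/-- The neighbours of an interior vertex, in cyclic order, starting at its target parent. -/
theorem exists_hexagon (hp : ¬ IsRoot p) (hpB : ¬ OnBoundary p) :
    ∃ ne nw w sw se : Vertex n, level p < level sw ∧ level p < level se ∧
      (∀ x, (lattice n).Adj p x ↔
        x = next p ∨ x = ne ∨ x = nw ∨ x = w ∨ x = sw ∨ x = se) ∧
      (lattice n).Adj (next p) ne ∧ (lattice n).Adj ne nw ∧ (lattice n).Adj nw w ∧
      (lattice n).Adj sw se ∧ (lattice n).Adj se (next p) := by
  have h0 := coords p
  have hnext := next_coords p
  unfold OnBoundary at hpB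
  have key : ∀ u v : Vertex n, u = v ↔ col u = col v ∧ row u = row v := fun u v =>
    ⟨fun h => h ▸ ⟨rfl, rfl⟩, fun h => vertex_ext h.1 h.2⟩
  rcases hnext with h1 | h1 | h1
  · exact absurd h1.1 hp
  · have h2 := @pt_coords n (col p) (row p - 1) (by omega)
    have h3 := @pt_coords n (col p + 1) (row p - 1) (by omega)
    have h4 := @pt_coords n (col p + 1) (row p) (by omega)
    have h5 := @pt_coords n (col p) (row p + 1) (by omega)
    have h6 := @pt_coords n (col p - 1) (row p + 1) (by omega)
    refine ⟨pt n (col p) (row p - 1), pt n (col p + 1) (row p - 1), pt n (col p + 1) (row p),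
      pt n (col p) (row p + 1), pt n (col p - 1) (row p + 1), ?_, ?_, fun x => ?_, ?_⟩
    · unfold level; omega
    · unfold level; omega
    · simp only [lattice_adj_iff, key, h1, h2, h3, h4, h5, h6]
      clear h0 hpB h1 h2 h3 h4 h5 h6
      constructor
      · rintro (⟨h, h' | h'⟩ | ⟨h, h' | h'⟩ | ⟨h, h' | h'⟩) <;> omega
      · rintro (h | h | h | h | h | h) <;> omega
    · clear h0 hpB
      refine ⟨?_, ?_, ?_, ?_, ?_⟩ <;> rw [lattice_adj_iff] <;> omega
  · have h2 := @pt_coords n (col p - 1) (row p + 1) (by omega)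
    have h3 := @pt_coords n (col p - 1) (row p) (by omega)
    have h4 := @pt_coords n (col p) (row p - 1) (by omega)
    have h5 := @pt_coords n (col p + 1) (row p - 1) (by omega)
    have h6 := @pt_coords n (col p + 1) (row p) (by omega)
    refine ⟨pt n (col p - 1) (row p + 1), pt n (col p - 1) (row p), pt n (col p) (row p - 1),
      pt n (col p + 1) (row p - 1), pt n (col p + 1) (row p), ?_, ?_, fun x => ?_, ?_⟩
    · unfold level; omega
    · unfold level; omega
    · simp only [lattice_adj_iff, key, h1, h2, h3, h4, h5, h6]
      clear h0 hpB h1 h2 h3 h4 h5 h6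
      constructor
      · rintro (⟨h, h' | h'⟩ | ⟨h, h' | h'⟩ | ⟨h, h' | h'⟩) <;> omega
      · rintro (h | h | h | h | h | h) <;> omega
    · clear h0 hpB
      refine ⟨?_, ?_, ?_, ?_, ?_⟩ <;> rw [lattice_adj_iff] <;> omega

theorem IsRooted.exists_spinsTo (hπ : IsRooted π) (h : ∀ v, Before v p → π v = next v) :
    ∃ π', SpinsTo (done p) π π' ∧ π' p = next p := by
  by_cases hp : IsRoot p
  · exact ⟨π, .refl hπ, hπ.eq_next_of_done h (.inr hp)⟩
  by_cases hpB : OnBoundary p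
  · exact hπ.exists_spinsTo_boundary h hp hpB
  obtain ⟨ne, nw, w, sw, se, hsw, hse, hnbr, h1, h2, h3, h5, h6⟩ := exists_hexagon hp hpB
  have hpF : p ∉ done p := fun h1 => h1.elim (Before.irrefl p) hp
  have heF : next p ∈ done p := .inl (before_next hp)
  have hswF : sw ∈ done p := .inl (.inl hsw)
  refine hπ.exists_spinsTo_interior (hπ.mapsTo_done h) hp hpF hpB heF hswF
    (.inl (.inl hse)) (fun _ => .inr) hnbr h1 h2 h3 h5 h6 (fun b hb hbp => ?_)
    fun hpsw b hb hbp => ?_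
  · rw [hπ.lineRoot_eq_of_reaches h hp hb hbp hpB, ← lineRoot_next p]
    exact hπ.reaches_lineRoot_of_done h heF
  · have h7 := hπ.lineRoot_eq_of_reaches h hp hb hbp hpB
    have h8 := hπ.root_unique (hπ.boundary b hb) ((hbp.trans (.of_eq hpsw)).trans
      (hπ.reaches_lineRoot_of_done h hswF)) (isRoot_lineRoot b) (isRoot_lineRoot sw)
    rw [← level_lineRoot p, ← level_lineRoot sw, ← h8, h7] at hsw
    exact lt_irrefl _ hsw

theorem IsRooted.spinsTo_next (hπ : IsRooted π) : SpinsTo ∅ π next := by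
  have outer : ∀ j : ℕ, ∃ σ, SpinsTo ∅ π σ ∧ ∀ v : Vertex n, n - j < level v → σ v = next v := by
    intro j
    induction j with
    | zero =>
      refine ⟨π, .refl hπ, fun v hv => ?_⟩
      have := coords v
      unfold level at hv
      omega
    | succ j IH =>
      have inner : ∀ t : ℕ, ∃ σ, SpinsTo ∅ π σ ∧ ∀ v : Vertex n,
          n - j < level v ∨ (level v = n - j ∧ pos v < t) → σ v = next v := by
        intro t
        induction t with
        | zero =>
          obtain ⟨σ, hσ, hσ'⟩ := IH
          refine ⟨σ, hσ, fun v hv => hσ' v ?_⟩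
          have := coords v
          have := level_pos_cases v
          omega
        | succ t ih =>
          obtain ⟨σ, hσ, hσ'⟩ := ih
          by_cases hex : ∃ p : Vertex n, level p = n - j ∧ pos p = t
          · obtain ⟨p, hp1, hp2⟩ := hex
            have hbefore : ∀ v, Before v p → σ v = next v := fun v hv => hσ' v (by
              unfold Before at hv; omega)
            obtain ⟨τ, hτ, hτp⟩ := hσ.rooted.exists_spinsTo hbefore
            refine ⟨τ, ⟨hτ.rooted, hσ.spins.trans hτ.spins, fun _ hv => hv.elim⟩, fun v hv => ?_⟩
            by_cases hvp : level v = n - j ∧ pos v = t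
            · rw [level_pos_injective (hvp.1.trans hp1.symm) (hvp.2.trans hp2.symm)]
              exact hτp
            · have hb : Before v p := by unfold Before; omega
              rw [hτ.eqOn (.inl hb)]
              exact hbefore v hb
          · refine ⟨σ, hσ, fun v hv => hσ' v ?_⟩
            have : ¬ (level v = n - j ∧ pos v = t) := fun h => hex ⟨v, h⟩
            omega
      obtain ⟨σ, hσ, hσ'⟩ := inner (2 * n + 1)
      refine ⟨σ, hσ, fun v hv => hσ' v ?_⟩
      have := coords v
      have := level_pos_cases v
      omega
  obtain ⟨σ, hσ, hσ'⟩ := outer (n + 1)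
  have hnext : σ = next := funext fun v => hσ' v (by
    have := coords v
    unfold level
    omega)
  exact hnext ▸ hσ

theorem forest_next : forest (next : Vertex n → Vertex n) = targetGrove n := by
  have key : ∀ u v : Vertex n, u ≠ v → (next u = v ↔
      ((row u < col u ∧ col u + row u < n ∧ col v = col u ∧ row v = row u + 1) ∨
        (col u ≤ row u ∧ 0 < col u ∧ col v = col u - 1 ∧ row v = row u))) := by
    intro u v huv
    have h0 := coords u
    have h1 := next_coords u
    have hne : ¬ (col u = col v ∧ row u = row v) := fun h => huv (vertex_ext h.1 h.2)
    constructor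
    · rintro rfl
      unfold IsRoot at h1
      rcases h1 with h1 | h1
      · exact absurd h1.2.symm huv
      · omega
    · intro h
      unfold IsRoot at h1
      apply vertex_ext <;> omega
  have rel : ∀ u v : Vertex n, (∃ k t : ℕ, t < k ∧ t + k < n ∧
      ((u.1 = (-(n : ℤ) + 2 * k + t, -(t : ℤ)) ∧
          v.1 = (-(n : ℤ) + 2 * k + t + 1, -(t : ℤ) - 1)) ∨
        (u.1 = (-(n : ℤ) + k + 2 * t, -(k : ℤ)) ∧
          v.1 = (-(n : ℤ) + k + 2 * t + 2, -(k : ℤ))))) ↔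
      ((row u < col u ∧ col u + row u < n ∧ col v = col u ∧ row v = row u + 1) ∨
        (col v ≤ row v ∧ 0 < col v ∧ col u = col v - 1 ∧ row u = row v)) := by
    intro u v
    have hu := coords u
    have hv := coords v
    simp only [val_eq_iff]
    constructor
    · rintro ⟨k, t, h1, h2, h | h⟩
      · left; omega
      · right; omega
    · rintro (h | h)
      · exact ⟨(col u).toNat, (row u).toNat, by omega, by omega, .inl (by omega)⟩
      · exact ⟨(row u).toNat, (col u).toNat, by omega, by omega, .inr (by omega)⟩
  ext u v
  simp only [targetGrove, SimpleGraph.fromRel_adj, rel]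
  change (u ≠ v ∧ (next u = v ∨ next v = u)) ↔ _
  refine and_congr_right fun huv => ?_
  rw [key u v huv, key v u huv.symm]
  have comm : ∀ a b c d : Prop, (a ∨ b) ∨ (c ∨ d) ↔ (a ∨ d) ∨ (c ∨ b) := by tauto
  exact comm _ _ _ _

end Connectivity
end Grove

theorem theorem3 (n : ℕ) (G : SimpleGraph (Grove.Vertex n))
    (hG : Grove.IsSimplifiedGrove n G) :
    Relation.ReflTransGen (Grove.GroveSpin n) G (Grove.targetGrove n) := by
  obtain ⟨π, hπ, rfl⟩ := hG.exists_forest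
  rw [← Grove.forest_next]
  exact hπ.spinsTo_next.spins
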